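/- Conventions: $\mathbb N=\{1,2,3,\dots\}$ and all graphs are finite and simple. A graph $G$ is $d$-degenerate if every nonempty subgraph of $G$ has a vertex of degree at most $d$ in that subgraph. A cover of a graph $G$ is a pair $\mathcal H=(L,H)$, where $H$ is a graph and $L:V(G)\to\mathcal P(V(H))$, such that: (1) the sets $L(u)$, $u\in V(G)$, are nonempty, pairwise disjoint and have union $V(H)$; (2) $H[L(u)]$ is complete for every $u\in V(G)$; (3) if there is an edge of $H$ between $L(u)$ and $L(v)$, then $u=v$ or $uv\in E(G)$; (4) if $uv\in E(G)$, then the edges of $H$ between $L(u)$ and $L(v)$ form a (possibly empty) matching. The cover is $a$-fold if $|L(u)|=a$ for all $u\in V(G)$. For $a,b\in\mathbb N$ with $a\ge b$, the graph $G$ is $(a,b)$-DP-colorable if for every $a$-fold cover $(L,H)$ of $G$ there is a set $S\subseteq V(H)$ such that $|S\cap L(v)|\ge b$ for every $v\in V(G)$ and $H$ has no edge joining a vertex of $S\cap L(u)$ to a vertex of $S\cap L(v)$ with $u\ne v$. **Proposition 1.3.** For each integer $k\ge 149$ there exist a $k$-degenerate bipartite graph $G$ and $a,b\in\mathbb N$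 with $a\ge b$ and $k>a/b$ such that $G$ is $(a,b)$-DP-colorable but not $(k,1)$-DP-colorable. Moreover, the complete bipartite graph $K_{k,t}$ has this property for all sufficiently large $t$: for each $k\ge149$ there is a $t_0$ such that for every $t\ge t_0$ the graph $G=K_{k,t}$ is $k$-degenerate and bipartite, is not $(k,1)$-DP-colorable, and is $(a,b)$-DP-colorable for some $a,b\in\mathbb N$ with $a\ge b$ and $k>a/b$. -/

import Mathlib

namespace FracDP

/-- `G` is `d`-degenerate: every (nonempty) subgraph of `G` has a vertex whose degree in that
subgraph is at most `d`. -/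
def IsDegenerate {V : Type*} (G : SimpleGraph V) (d : ℕ) : Prop :=
  ∀ K : G.Subgraph, K.verts.Nonempty → ∃ v ∈ K.verts, (K.neighborSet v).encard ≤ d

/-- A cover `(L, H)` of the graph `G`, where `W` is the vertex set of `H`. -/
structure Cover {V : Type*} (G : SimpleGraph V) (W : Type*) where
  /-- the graph on the vertex set `W` -/
  H : SimpleGraph W
  /-- the part of `W` that belongs to a vertex of `G` -/
  L : V → Set W
  -- the sets `L u` form a partition of `W`, indexed by the vertices of `G`
  nonempty : ∀ u, (L u).Nonempty
  disjoint : ∀ u v, u ≠ v → Disjoint (L u) (L v)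
  iUnion_eq : ⋃ u, L u = Set.univ
  -- each `H[L u]` is complete
  isClique : ∀ u, H.IsClique (L u)
  -- edges of `H` run inside a part or between the parts of adjacent vertices of `G`
  adj_of_adj : ∀ u v, ∀ x ∈ L u, ∀ y ∈ L v, H.Adj x y → u = v ∨ G.Adj u v
  -- for adjacent `u`, `v`, no vertex of `L u` has two neighbours in `L v`; applied to both `(u, v)`
  -- and `(v, u)`, this says that the edges between `L u` and `L v` form a (possibly empty) matching
  matching : ∀ u v, G.Adj u v → ∀ x ∈ L u, ∀ y ∈ L v, ∀ z ∈ L v,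
    H.Adj x y → H.Adj x z → y = z

namespace Cover

variable {V W : Type*} {G : SimpleGraph V}

/-- The cover is `a`-fold: each part has exactly `a` elements. -/
def IsFold (C : Cover G W) (a : ℕ) : Prop :=
  ∀ u, (C.L u).encard = a

/-- `S` is quasi-independent: `H[S]` contains no cross-edge, that is, no edge between two
different parts. -/
def QuasiIndependent (C : Cover G W) (S : Set W) : Prop :=
  ∀ u v, u ≠ v → ∀ x ∈ S ∩ C.L u, ∀ y ∈ S ∩ C.L v, ¬ C.H.Adj x y

/-- `G` is `(C, b)`-colorable: some quasi-independent set meets each part in at least `b`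
elements. -/
def Colorable (C : Cover G W) (b : ℕ) : Prop :=
  ∃ S : Set W, C.QuasiIndependent S ∧ ∀ v, (b : ℕ∞) ≤ (S ∩ C.L v).encard

end Cover

/-- `G` is `(a, b)`-DP-colorable (a notion for finite graphs `G` and `1 ≤ b ≤ a`). The graph `H` of
an `a`-fold cover of a finite graph is finite, so `W : Type` covers all cases up to isomorphism. -/
def DPColorable {V : Type*} (G : SimpleGraph V) (a b : ℕ) : Prop :=
  ∀ (W : Type) (C : Cover G W), C.IsFold a → C.Colorable b

end FracDP

namespace FracDP

open Finset

/-! Not `(k, 1)`: once `t ≥ k ^ k`, a cover can assign to each choice of one element from every list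
on the `k`-side a vertex on the `t`-side whose whole list that choice blocks (`transversalCover`).
`(k * m, m + 1)` for large `m`: select each element of the `k`-side lists independently with
probability `2 / k`, and on the `t`-side keep every element with no selected neighbour. A `k`-side
list has `2m` selected elements on average. A `t`-side element has at most `k` neighbours on the
`k`-side, so it survives with probability at least `(1 - 2/k) ^ k ≥ 2 / k`, again giving mean at
least `2m`. Matchings make survival independent within a list, so Chebyshev (`card_deviation_le`)
and a union bound over the `k + t` lists leave more than `m` elements in each. Finally `k * m / (m +
1) < k`. -/

/-! ### Second moment method, by counting maps into `Fin k` -/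

/-- The number of maps `W → Fin k` that take no value below `2` on the finite set `N`. -/
theorem sum_prod_indicator {W : Type*} [Fintype W] [DecidableEq W] {k : ℕ} (hk : 2 ≤ k)
    (N : Finset W) :
    ∑ ω : W → Fin k, ∏ w ∈ N, (if 2 ≤ (ω w).val then (1 : ℝ) else 0) =
      (k : ℝ) ^ Fintype.card W * (1 - 2 / (k : ℝ)) ^ #N := by
  have hk0 : (k : ℝ) ≠ 0 := by positivity
  have hcard : ∑ j : Fin k, (if 2 ≤ j.val then (1 : ℝ) else 0) = k * (1 - 2 / k) := by
    rw [Fin.sum_univ_eq_sum_range (fun j => if 2 ≤ j then (1 : ℝ) else 0) k]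
    obtain ⟨n, rfl⟩ := Nat.exists_eq_add_of_le hk
    rw [Finset.sum_range_add]
    simp only [Nat.cast_add, Nat.cast_ofNat] at hk0 ⊢
    field_simp
    simp
  have h : ∀ ω : W → Fin k, ∏ w ∈ N, (if 2 ≤ (ω w).val then (1 : ℝ) else 0) =
      ∏ w, if w ∈ N then (if 2 ≤ (ω w).val then (1 : ℝ) else 0) else 1 := by
    intro ω
    rw [Finset.prod_ite_mem, Finset.univ_inter]
  simp_rw [h]
  rw [← Fintype.piFinset_univ, Finset.sum_prod_piFinset (Finset.univ : Finset (Fin k))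
    (fun w j => if w ∈ N then (if 2 ≤ j.val then (1 : ℝ) else 0) else 1)]
  have h2 : ∀ w : W, ∑ j : Fin k, (if w ∈ N then (if 2 ≤ j.val then (1 : ℝ) else 0) else 1) =
      k * (if w ∈ N then 1 - 2 / (k : ℝ) else 1) := by
    intro w
    split_ifs
    · exact hcard
    · simp
  simp_rw [h2]
  rw [Finset.prod_mul_distrib, Finset.prod_ite_mem, Finset.univ_inter]
  simp

/-- Disjoint sets give independent events, so the variance is a sum of `#I` single variances, each
at most 1. -/
theorem sum_sq_deviation_le {W ι : Type*} [Fintype W] [DecidableEq W] {k : ℕ}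
    (hk : 2 ≤ k) (I : Finset ι) (N : ι → Finset W)
    (hN : ∀ i ∈ I, ∀ j ∈ I, i ≠ j → Disjoint (N i) (N j)) :
    ∑ ω : W → Fin k, ((#{i ∈ I | ∀ w ∈ N i, 2 ≤ (ω w).val} : ℝ) -
      ∑ i ∈ I, (1 - 2 / (k : ℝ)) ^ #(N i)) ^ 2 ≤ #I * (k : ℝ) ^ Fintype.card W := by
  classical
  set q : ℝ := 1 - 2 / (k : ℝ) with hq
  have hk' : (2 : ℝ) ≤ k := by exact_mod_cast hk
  have hq0 : 0 ≤ q := by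
    rw [hq, sub_nonneg, div_le_one (by positivity)]; exact hk'
  have hq1 : q ≤ 1 := by
    rw [hq]; have : 0 ≤ 2 / (k : ℝ) := by positivity
    linarith
  let X : Finset W → (W → Fin k) → ℝ := fun M ω =>
    ∏ w ∈ M, (if 2 ≤ (ω w).val then (1 : ℝ) else 0)
  have hX : ∀ M ω, X M ω = if ∀ w ∈ M, 2 ≤ (ω w).val then 1 else 0 := by
    intro M ω
    simp only [X, Finset.prod_ite_zero, Finset.prod_const_one]
  have hE : ∀ M, ∑ ω, X M ω = (k : ℝ) ^ Fintype.card W * q ^ #M := fun M =>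
    sum_prod_indicator hk M
  have hone : ∑ _ω : W → Fin k, (1 : ℝ) = (k : ℝ) ^ Fintype.card W := by simp
  have hcount : ∀ ω : W → Fin k, (#{i ∈ I | ∀ w ∈ N i, 2 ≤ (ω w).val} : ℝ) -
      ∑ i ∈ I, q ^ #(N i) = ∑ i ∈ I, (X (N i) ω - q ^ #(N i)) := by
    intro ω
    rw [Finset.sum_sub_distrib, Finset.card_filter]
    push_cast
    simp_rw [hX]
  simp_rw [hcount, sq, Finset.sum_mul_sum]
  rw [Finset.sum_comm]
  have hrow : ∀ i ∈ I, ∑ ω, ∑ j ∈ I, (X (N i) ω - q ^ #(N i)) * (X (N j) ω - q ^ #(N j)) ≤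
      (k : ℝ) ^ Fintype.card W := by
    intro i hi
    rw [Finset.sum_comm, Finset.sum_eq_single i]
    · rw [← hone]
      refine Finset.sum_le_sum fun ω _ => ?_
      have h1 : 0 ≤ q ^ #(N i) := pow_nonneg hq0 _
      have h2 : q ^ #(N i) ≤ 1 := pow_le_one₀ hq0 hq1
      rw [hX]
      split_ifs <;> nlinarith
    -- Covariances vanish: for disjoint sets the indicator of the union is the product of the
    -- indicators.
    · intro j hj hji
      have hd := hN i hi j hj hji.symm
      have hmul : ∀ ω, (X (N i) ω - q ^ #(N i)) * (X (N j) ω - q ^ #(N j)) =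
          X (N i ∪ N j) ω - q ^ #(N j) * X (N i) ω - q ^ #(N i) * X (N j) ω +
            q ^ #(N i) * q ^ #(N j) * 1 := by
        intro ω
        have : X (N i ∪ N j) ω = X (N i) ω * X (N j) ω := Finset.prod_union hd
        rw [this]; ring
      simp_rw [hmul]
      rw [Finset.sum_add_distrib, Finset.sum_sub_distrib, Finset.sum_sub_distrib,
        ← Finset.mul_sum, ← Finset.mul_sum, ← Finset.mul_sum, hE, hE, hE, hone,
        Finset.card_union_of_disjoint hd]
      ring
    · exact fun h => absurd hi h
  calc _ ≤ ∑ i ∈ I, (k : ℝ) ^ Fintype.card W := Finset.sum_le_sum hrow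
    _ = _ := by simp

/-- Chebyshev's inequality for the number of sets in a disjoint family on which a random map takes
no value below `2`. -/
theorem card_deviation_le {W ι : Type*} [Fintype W] [DecidableEq W] {k : ℕ}
    (hk : 2 ≤ k) (I : Finset ι) (N : ι → Finset W)
    (hN : ∀ i ∈ I, ∀ j ∈ I, i ≠ j → Disjoint (N i) (N j)) (m : ℝ) (hm : 0 ≤ m)
    (B : Finset (W → Fin k))
    (hB : ∀ ω ∈ B, m ≤ |(#{i ∈ I | ∀ w ∈ N i, 2 ≤ (ω w).val} : ℝ) -
      ∑ i ∈ I, (1 - 2 / (k : ℝ)) ^ #(N i)|) :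
    #B * m ^ 2 ≤ #I * (k : ℝ) ^ Fintype.card W := by
  refine le_trans ?_ (sum_sq_deviation_le hk I N hN)
  calc (#B : ℝ) * m ^ 2 = ∑ _ω ∈ B, m ^ 2 := by simp
    _ ≤ ∑ ω ∈ B, ((#{i ∈ I | ∀ w ∈ N i, 2 ≤ (ω w).val} : ℝ) -
      ∑ i ∈ I, (1 - 2 / (k : ℝ)) ^ #(N i)) ^ 2 := by
        refine Finset.sum_le_sum fun ω hω => ?_
        rw [← sq_abs (_ - _)]
        exact pow_le_pow_left₀ hm (hB ω hω) 2
    _ ≤ _ := Finset.sum_le_sum_of_subset_of_nonneg (Finset.subset_univ _)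
        fun _ _ _ => sq_nonneg _

/-- Since `1 - 2/k` is the reciprocal of `1 + 2/(k-2)`, its `k`-th power is at least `exp
(-2k/(k-2)) ≥ exp (-3) ≥ 1/27 ≥ 2/k`. -/
theorem two_div_le_one_sub_two_div_pow {k : ℕ} (hk : 149 ≤ k) :
    2 / (k : ℝ) ≤ (1 - 2 / (k : ℝ)) ^ k := by
  have hk' : (149 : ℝ) ≤ k := by exact_mod_cast hk
  have hpos : 0 < (k : ℝ) - 2 := by linarith
  have h1 : Real.exp (-(2 / ((k : ℝ) - 2))) ≤ 1 - 2 / (k : ℝ) := by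
    rw [Real.exp_neg]
    have h := Real.add_one_le_exp (2 / ((k : ℝ) - 2))
    have h2 : 1 - 2 / (k : ℝ) = (2 / ((k : ℝ) - 2) + 1)⁻¹ := by
      field_simp
      ring
    rw [h2]
    exact inv_anti₀ (by positivity) h
  have h3 : Real.exp (-3) ≤ Real.exp (-(2 / ((k : ℝ) - 2))) ^ k := by
    rw [← Real.exp_nat_mul, Real.exp_le_exp]
    rw [mul_neg, neg_le_neg_iff, mul_div_assoc', div_le_iff₀ hpos]
    linarith
  have h4 : 2 / (k : ℝ) ≤ Real.exp (-3) := by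
    rw [Real.exp_neg, div_le_iff₀ (by linarith), ← div_eq_inv_mul, le_div_iff₀ (Real.exp_pos _)]
    have h5 : Real.exp 3 ≤ 27 := by
      have := Real.exp_one_lt_d9
      calc Real.exp 3 = Real.exp 1 ^ 3 := by rw [← Real.exp_nat_mul]; norm_num
        _ ≤ 3 ^ 3 := pow_le_pow_left₀ (Real.exp_pos _).le (by linarith) 3
        _ = 27 := by norm_num
    linarith
  exact h4.trans (h3.trans (pow_le_pow_left₀ (Real.exp_pos _).le h1 k))

/-! ### Degeneracy and bipartiteness -/

theorem isDegenerate_completeBipartiteGraph (k t : ℕ) :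
    IsDegenerate (completeBipartiteGraph (Fin k) (Fin t)) k := by
  intro K hK
  -- A vertex on the `t`-side has degree at most `k`; without one the subgraph has no edges.
  by_cases h : ∃ v, Sum.inr v ∈ K.verts
  · obtain ⟨v, hv⟩ := h
    refine ⟨_, hv, ?_⟩
    have hsub : K.neighborSet (Sum.inr v) ⊆ Set.range (Sum.inl : Fin k → Fin k ⊕ Fin t) := by
      rintro (u | u) hu
      · exact ⟨u, rfl⟩
      · exact absurd (K.adj_sub hu) (by simp)
    calc _ ≤ (Set.range (Sum.inl : Fin k → Fin k ⊕ Fin t)).encard := Set.encard_le_encard hsub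
      _ = k := by
        rw [← Set.image_univ, Sum.inl_injective.encard_image]
        simp
  · obtain ⟨v, hv⟩ := hK
    refine ⟨v, hv, ?_⟩
    have : K.neighborSet v = ∅ := by
      rw [Set.eq_empty_iff_forall_notMem]
      rintro (u | u) hu
      · rcases v with v | v
        · exact absurd (K.adj_sub hu) (by simp)
        · exact h ⟨v, hv⟩
      · exact h ⟨u, K.edge_vert (K.adj_symm hu)⟩
    simp [this]

theorem isBipartite_completeBipartiteGraph (α β : Type*) :
    (completeBipartiteGraph α β).IsBipartite := by
  refine ⟨SimpleGraph.Coloring.mk (fun x => Sum.elim (fun _ => (0 : Fin 2)) (fun _ => 1) x) ?_⟩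
  rintro (u | u) (v | v) h <;> simp_all

/-! ### A cover that defeats every transversal -/

/-- The `k`-fold cover of `K_{k,t}` in which, for every `v` on the side of size `t` and every `i`,
the vertex `(v, i)` is matched with the vertex `(i, g v i)`. -/
def transversalCover {k t : ℕ} (hk : 0 < k) (g : Fin t → Fin k → Fin k) :
    Cover (completeBipartiteGraph (Fin k) (Fin t)) ((Fin k ⊕ Fin t) × Fin k) where
  H := SimpleGraph.fromRel fun x y => x.1 = y.1 ∨
    ∃ i v, x = (Sum.inl i, g v i) ∧ y = (Sum.inr v, i)
  L u := {x | x.1 = u}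
  nonempty u := ⟨(u, ⟨0, hk⟩), rfl⟩
  disjoint u v huv := by
    rw [Set.disjoint_left]
    rintro x rfl h
    exact huv h
  iUnion_eq := by ext x; simp
  isClique u := by
    rintro x rfl y hy hxy
    exact ⟨hxy, Or.inl (Or.inl hy.symm)⟩
  adj_of_adj := by
    rintro u v x rfl y rfl ⟨_, (h | ⟨i, w, rfl, rfl⟩) | h | ⟨i, w, rfl, rfl⟩⟩
    · exact Or.inl h
    · exact Or.inr (by simp)
    · exact Or.inl h.symm
    · exact Or.inr (by simp)
  matching := by
    rintro u v huv x rfl y rfl z hz ⟨_, hxy⟩ ⟨_, hxz⟩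
    have hne := huv.ne
    have hne' : x.1 ≠ z.1 := fun h => hne (h.trans hz)
    rcases hxy with (h | ⟨i, w, hx, hy⟩) | h | ⟨i, w, hy, hx⟩
    · exact absurd h hne
    · rcases hxz with (h | ⟨i', w', hx', hz'⟩) | h | ⟨i', w', hz', hx'⟩
      · exact absurd h hne'
      · rw [hx] at hx'
        simp only [Prod.mk.injEq, Sum.inl.injEq] at hx'
        rw [hy, hz'] at hz
        simp only [Set.mem_ofPred_eq, Sum.inr.injEq] at hz
        rw [hy, hz', hz, hx'.1]
      · exact absurd h.symm hne'
      · simp [hx] at hx'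
    · exact absurd h.symm hne
    · rcases hxz with (h | ⟨i', w', hx', hz'⟩) | h | ⟨i', w', hz', hx'⟩
      · exact absurd h hne'
      · simp [hx] at hx'
      · exact absurd h.symm hne'
      · rw [hx] at hx'
        simp only [Prod.mk.injEq, Sum.inr.injEq] at hx'
        rw [hy, hz', hx'.1, hx'.2]

theorem not_dpColorable_completeBipartiteGraph {k t : ℕ} (hk : 0 < k) (ht : k ^ k ≤ t) :
    ¬ DPColorable (completeBipartiteGraph (Fin k) (Fin t)) k 1 := by
  intro h
  obtain ⟨e⟩ : Nonempty ((Fin k → Fin k) ↪ Fin t) :=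
    Function.Embedding.nonempty_of_card_le (by simpa using ht)
  have : Nonempty (Fin k → Fin k) := ⟨id⟩
  obtain ⟨S, hS, hcard⟩ := h _ (transversalCover hk (Function.invFun e)) <| by
    intro u
    have : (transversalCover hk (Function.invFun e)).L u = Set.range (fun i : Fin k => (u, i)) := by
      ext ⟨x, i⟩
      simp [transversalCover, eq_comm]
    rw [this, ← Set.image_univ, (Prod.mk_right_injective u).encard_image]
    simp
  have hne : ∀ v, ∃ j, (v, j) ∈ S := by
    intro v
    have h1 := hcard v
    rw [Nat.cast_one, Set.one_le_encard_iff_nonempty] at h1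
    obtain ⟨⟨w, j⟩, hj, rfl⟩ := h1
    exact ⟨j, hj⟩
  choose f hf using fun i : Fin k => hne (Sum.inl i)
  -- The vertex `e f` encodes the choice `f`: each element `j` of its list is matched to `(j, f j)`,
  -- which lies in `S`.
  obtain ⟨j, hj⟩ := hne (Sum.inr (e f))
  refine hS (Sum.inl j) (Sum.inr (e f)) (by simp) _ ⟨hf j, rfl⟩ _ ⟨hj, rfl⟩ ?_
  refine ⟨by simp, Or.inl (Or.inr ⟨j, e f, ?_, rfl⟩)⟩
  rw [Function.leftInverse_invFun e.injective]

/-! ### Random fractional coloring -/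

theorem dpColorable_completeBipartiteGraph {k : ℕ} (hk : 149 ≤ k) (t m : ℕ)
    (hm : k * (k + t) < m) :
    DPColorable (completeBipartiteGraph (Fin k) (Fin t)) (k * m) (m + 1) := by
  classical
  intro W C hC
  have hLfin : ∀ u, (C.L u).Finite := fun u => by
    rw [← Set.encard_ne_top_iff, hC u]; exact ENat.natCast_ne_top _
  have hWfin : Finite W := by
    rw [← Set.finite_univ_iff, ← C.iUnion_eq]
    exact Set.finite_iUnion hLfin
  have := Fintype.ofFinite W
  have hk2 : 2 ≤ k := by omega
  have hkR : (149 : ℝ) ≤ k := by exact_mod_cast hk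
  have hm0 : 0 < m := by omega
  have hmR : (0 : ℝ) < m := by exact_mod_cast hm0
  let P : Fin k ⊕ Fin t → Finset W := fun u => (C.L u).toFinset
  have hP : ∀ u x, x ∈ P u ↔ x ∈ C.L u := fun u x => Set.mem_toFinset
  have hPcard : ∀ u, #(P u) = k * m := fun u => by
    have h := hC u
    rw [← Set.coe_toFinset (C.L u), Set.encard_coe_eq_coe_finsetCard] at h
    exact_mod_cast h
  let A : Finset W := {w | ∃ u, w ∈ C.L (Sum.inl u)}
  -- the vertices that must not be selected for `x` to survive
  let N : Fin k ⊕ Fin t → W → Finset W :=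
    Sum.elim (fun _ x => {x}) (fun _ x => {w ∈ A | C.H.Adj x w})
  -- An element is selected when `ω` is below 2. On the `k`-side `alive` thus means unselected, so
  -- one deviation bound serves both sides.
  let alive : Fin k ⊕ Fin t → (W → Fin k) → Finset W :=
    fun u ω => {x ∈ P u | ∀ w ∈ N u x, 2 ≤ (ω w).val}
  have hNdisj : ∀ u, ∀ x ∈ P u, ∀ y ∈ P u, x ≠ y → Disjoint (N u x) (N u y) := by
    rintro (u | v) x hx y hy hxy
    · simpa [N] using hxy
    · rw [Finset.disjoint_left]
      intro w hw hw'
      simp only [N, A, Sum.elim_inr, Finset.mem_filter, Finset.mem_univ, true_and] at hw hw'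
      obtain ⟨⟨u, hu⟩, hxw⟩ := hw
      exact hxy (C.matching (Sum.inl u) (Sum.inr v) (by simp) w hu x ((hP _ _).1 hx) y
        ((hP _ _).1 hy) hxw.symm hw'.2.symm)
  have hNcard : ∀ v, ∀ x ∈ P (Sum.inr v), #(N (Sum.inr v) x) ≤ k := by
    intro v x hx
    have hex : ∀ w ∈ N (Sum.inr v) x, ∃ u, w ∈ C.L (Sum.inl u) := by
      intro w hw
      simp only [N, A, Sum.elim_inr, Finset.mem_filter, Finset.mem_univ, true_and] at hw
      exact hw.1
    choose f hf using hex
    have hle : #(N (Sum.inr v) x).attach ≤ #(Finset.univ : Finset (Fin k)) := by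
      refine Finset.card_le_card_of_injOn (fun w => f w.1 w.2) (fun _ _ => by simp) ?_
      rintro ⟨w, hw⟩ - ⟨w', hw'⟩ - hww
      have h1 := hf w hw
      have h2 := hf w' hw'
      simp only at hww
      rw [← hww] at h2
      simp only [N, Sum.elim_inr, Finset.mem_filter] at hw hw'
      exact Subtype.ext (C.matching (Sum.inr v) (Sum.inl _) (by simp) x ((hP _ _).1 hx) w h1 w' h2
        hw.2 hw'.2)
    simpa using hle
  set q : ℝ := 1 - 2 / (k : ℝ) with hq
  have hq0 : 0 ≤ q := by
    rw [hq, sub_nonneg, div_le_one (by linarith)]; linarith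
  have hq1 : q ≤ 1 := by
    rw [hq]; have : 0 ≤ 2 / (k : ℝ) := by positivity
    linarith
  let bad : Fin k ⊕ Fin t → Finset (W → Fin k) := fun u =>
    {ω | (m : ℝ) ≤ |(#(alive u ω) : ℝ) - ∑ x ∈ P u, q ^ #(N u x)|}
  have hbad : ∀ u, (#(bad u) : ℝ) * m ^ 2 ≤ (k * m : ℕ) * (k : ℝ) ^ Fintype.card W := by
    intro u
    have h := card_deviation_le hk2 (P u) (N u) (hNdisj u) m hmR.le (bad u)
      (fun ω hω => (Finset.mem_filter.1 hω).2)
    rwa [hPcard u] at h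
  -- Union bound: each list is bad with probability at most `k / m`, and `k * (k + t) < m`.
  obtain ⟨ω, hω⟩ : ∃ ω, ∀ u, ω ∉ bad u := by
    by_contra! hcon
    have hcov : (Finset.univ : Finset (W → Fin k)) ⊆ Finset.univ.biUnion bad := fun ω _ => by
      obtain ⟨u, hu⟩ := hcon ω
      exact Finset.mem_biUnion.2 ⟨u, Finset.mem_univ _, hu⟩
    have h1 : (k : ℝ) ^ Fintype.card W ≤ ∑ u, (#(bad u) : ℝ) := by
      have := (Finset.card_le_card hcov).trans Finset.card_biUnion_le
      rw [Finset.card_univ, Fintype.card_fun, Fintype.card_fin] at this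
      exact_mod_cast this
    have h2 : (∑ u, (#(bad u) : ℝ)) * m ^ 2 ≤
        ((k : ℝ) + t) * ((k * m : ℕ) * (k : ℝ) ^ Fintype.card W) := by
      rw [Finset.sum_mul]
      refine (Finset.sum_le_sum fun u _ => hbad u).trans_eq ?_
      simp
    have hpow : (0 : ℝ) < (k : ℝ) ^ Fintype.card W := by positivity
    have hmR' : (k : ℝ) * (k + t) < m := by exact_mod_cast hm
    have h3 : (k : ℝ) ^ Fintype.card W * m * m ≤
        (k : ℝ) ^ Fintype.card W * m * (k * (k + t)) := by
      push_cast at h2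
      nlinarith [mul_le_mul_of_nonneg_right h1 (sq_nonneg (m : ℝ))]
    exact absurd (le_of_mul_le_mul_left h3 (by positivity)) (not_le.2 hmR')
  have hdev : ∀ u, |(#(alive u ω) : ℝ) - ∑ x ∈ P u, q ^ #(N u x)| < m := fun u => by
    have := hω u
    simpa [bad] using this
  refine ⟨{w | (∃ u, w ∈ C.L (Sum.inl u) ∧ (ω w).val < 2) ∨
    ∃ v, w ∈ C.L (Sum.inr v) ∧ ∀ z ∈ A, C.H.Adj w z → 2 ≤ (ω z).val}, ?_, ?_⟩
  · have huniq : ∀ u v x, x ∈ C.L u → x ∈ C.L v → u = v := fun u v x hu hv => by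
      by_contra hne
      exact Set.disjoint_left.1 (C.disjoint u v hne) hu hv
    have hmix : ∀ u v x y, x ∈ C.L (Sum.inl u) → y ∈ C.L (Sum.inr v) →
        ((∃ u, x ∈ C.L (Sum.inl u) ∧ (ω x).val < 2) ∨
          ∃ v, x ∈ C.L (Sum.inr v) ∧ ∀ z ∈ A, C.H.Adj x z → 2 ≤ (ω z).val) →
        ((∃ u, y ∈ C.L (Sum.inl u) ∧ (ω y).val < 2) ∨
          ∃ v, y ∈ C.L (Sum.inr v) ∧ ∀ z ∈ A, C.H.Adj y z → 2 ≤ (ω z).val) →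
        ¬ C.H.Adj x y := by
      intro u v x y hx hy hxS hyS hadj
      rcases hxS with ⟨_, _, hlt⟩ | ⟨v', hv', _⟩
      · rcases hyS with ⟨u', hu', _⟩ | ⟨_, _, hall⟩
        · exact absurd (huniq _ _ y hy hu') (by simp)
        · have := hall x (by simpa [A] using ⟨u, hx⟩) hadj.symm
          omega
      · exact absurd (huniq _ _ x hx hv') (by simp)
    rintro (u | u) (v | v) huv x ⟨hxS, hx⟩ y ⟨hyS, hy⟩ hadj
    · exact (C.adj_of_adj _ _ x hx y hy hadj).elim huv (by simp)
    · exact hmix u v x y hx hy hxS hyS hadj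
    · exact hmix v u y x hy hx hyS hxS hadj.symm
    · exact (C.adj_of_adj _ _ x hx y hy hadj).elim huv (by simp)
  · have hfinish : ∀ u (T : Finset W) (S : Set W), (↑T : Set W) ⊆ S ∩ C.L u → (m : ℝ) < #T →
        ((m + 1 : ℕ) : ℕ∞) ≤ (S ∩ C.L u).encard := by
      intro u T S hT hlt
      refine le_trans ?_ (Set.encard_le_encard hT)
      rw [Set.encard_coe_eq_coe_finsetCard]
      have : m + 1 ≤ #T := by exact_mod_cast hlt
      exact_mod_cast this
    rintro (u | v)
    -- About `k * m - 2 * m` elements are unselected, with error below `m`, so more than `m` are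
    -- selected.
    · refine hfinish _ (P (Sum.inl u) \ alive (Sum.inl u) ω) _ ?_ ?_
      · intro x hx
        simp only [alive, N, Sum.elim_inl, Finset.coe_sdiff, Set.mem_sdiff, Finset.mem_coe,
          Finset.mem_filter, Finset.mem_singleton, forall_eq, not_and, not_le] at hx
        have hxL := (hP _ _).1 hx.1
        exact ⟨Or.inl ⟨u, hxL, hx.2 hx.1⟩, hxL⟩
      · have hsub : alive (Sum.inl u) ω ⊆ P (Sum.inl u) := Finset.filter_subset _ _
        rw [Finset.cast_card_sdiff hsub, hPcard]
        have h := (abs_lt.1 (hdev (Sum.inl u))).2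
        simp only [N, Sum.elim_inl, Finset.card_singleton, pow_one, Finset.sum_const, hPcard,
          nsmul_eq_mul] at h
        have hkm : ((k * m : ℕ) : ℝ) * q = k * m - 2 * m := by
          rw [hq]; push_cast; field_simp
        rw [hkm] at h
        push_cast
        linarith
    · refine hfinish _ (alive (Sum.inr v) ω) _ ?_ ?_
      · intro x hx
        simp only [alive, N, Sum.elim_inr, Finset.mem_coe, Finset.mem_filter] at hx
        have hxL := (hP _ _).1 hx.1
        exact ⟨Or.inr ⟨v, hxL, fun z hz hadj => hx.2 z ⟨hz, hadj⟩⟩, hxL⟩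
      · have h := (abs_lt.1 (hdev (Sum.inr v))).1
        have hsum : 2 * (m : ℝ) ≤ ∑ x ∈ P (Sum.inr v), q ^ #(N (Sum.inr v) x) := by
          calc 2 * (m : ℝ) = ∑ _x ∈ P (Sum.inr v), 2 / (k : ℝ) := by
                rw [Finset.sum_const, hPcard, nsmul_eq_mul]; push_cast; field_simp
            _ ≤ _ := Finset.sum_le_sum fun x hx =>
                (two_div_le_one_sub_two_div_pow hk).trans
                  (pow_le_pow_of_le_one hq0 hq1 (hNcard v x hx))
        linarith

end FracDP

theorem proposition1p3 (k : ℕ) (hk : 149 ≤ k) :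
    ∃ t₀ : ℕ, ∀ t : ℕ, t₀ ≤ t →
      FracDP.IsDegenerate (completeBipartiteGraph (Fin k) (Fin t)) k ∧
      (completeBipartiteGraph (Fin k) (Fin t)).IsBipartite ∧
      ∃ a b : ℕ, 1 ≤ b ∧ b ≤ a ∧ (a : ℝ) / (b : ℝ) < (k : ℝ) ∧
        FracDP.DPColorable (completeBipartiteGraph (Fin k) (Fin t)) a b ∧
        ¬ FracDP.DPColorable (completeBipartiteGraph (Fin k) (Fin t)) k 1 := by
  -- Here `m = k * (k + t) + 1`, the least value the union bound allows.
  refine ⟨k ^ k, fun t ht => ⟨FracDP.isDegenerate_completeBipartiteGraph k t,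
    FracDP.isBipartite_completeBipartiteGraph _ _, k * (k * (k + t) + 1), k * (k + t) + 1 + 1,
    by omega, ?_, ?_,
    FracDP.dpColorable_completeBipartiteGraph hk t _ (Nat.lt_succ_self _),
    FracDP.not_dpColorable_completeBipartiteGraph (by omega) ht⟩⟩
  · have : 2 * (k * (k + t) + 1) ≤ k * (k * (k + t) + 1) := Nat.mul_le_mul_right _ (by omega)
    omega
  · have hk' : (149 : ℝ) ≤ k := by exact_mod_cast hk
    rw [div_lt_iff₀ (by positivity)]
    push_cast
    nlinarith
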